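/- **Theorem (Importance Depth Bound).** An $m$-elimination tournament on $k\ge 1$ labels ($m\ge 1$) consists of two phases. *First phase.* There are $m$ single-elimination tournaments $W_1,\dots,W_m$, each over all $k$ labels. All labels start in $W_1$; for $i<m$, a label enters $W_{i+1}$ as soon as it has lost in $W_i$ or has won $W_i$ (that is, every other label has lost in $W_i$). In each round, in every $W_i$, the labels present in $W_i$ that have not lost in it are paired off, with one label sitting out if their number is odd, and the loser of each game is eliminated from $W_i$. Who is paired with whom is arbitrary and may depend on the earlier results. The phase ends when each $W_i$ has a single label left; its length is the number of rounds played. *Second phase.* The $m$ winners, one entrant for each $W_i$, play a single-elimination tournament, in which in each round the remaining entrants are paired off (arbitrarily, possibly depending on the earlier results of this phase), with one entrant sitting out if their number is odd. An entrant that has emerged from a subtree $Q$ has charge $c_Q$, the number of leaves of $Q$ (so initially $1$). A match between the winners of subtrees $A$ and $B$ has importance weight $0$ if their labels coincide; otherwise its importance weight is $c_A$ or $c_B$, and in the worst case $\max(c_A,c_B)$. A match of importance weight $w$ is played as $w$ repeated games, and the length of a round is the largest number of games among its matches. The *importance depth* is the largest total length of the two phases over all possible outcomes of the games and matches. Let $\lceil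 m\rceil_2$ be the smallest power of $2$ that is at least $m$. Then for all $k,m\ge 1$, every $m$-elimination tournament on $k$ labels has finite importance depth, and it is at most each of $$\lceil \log_2 k\rceil + m \lceil \log_2 (\lceil \log_2 k \rceil + 1)\rceil + \lceil m \rceil_2,$$ $$1.5 \lceil \log_2 k \rceil + 3 m + \lceil m \rceil_2,$$ $$\lceil k/2 \rceil + 2 m + \lceil m \rceil_2,$$ and, if $k\le 2^{62}$ and $m\le 4\log_2 k$, also at most $$2m + \lceil m\rceil_2 + 2\ln k+2\sqrt{m\ln k}.$$ -/

import Mathlib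

/-- The pairing of one round among the competitors waiting in `W`: `σ x` is the opponent of `x`,
and `σ x = x` means that `x` does not play this round.  Everybody is paired, except one competitor
if the number of competitors is odd. -/
structure IsPairing {α : Type} (W : Finset α) (σ : α → α) : Prop where
  mem : ∀ x ∈ W, σ x ∈ W
  invol : ∀ x ∈ W, σ (σ x) = x
  bye : ∀ x ∈ W, ∀ y ∈ W, σ x = x → σ y = y → x = y

namespace EliminationTournament

/-- A state of the first phase: for each of the `m` single-elimination tournaments on the `k`
labels, the set of labels that have not lost in it yet. -/
abbrev State (k m : ℕ) : Type := Fin m → Finset (Fin k)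

open Classical in
/-- The labels that wait for a game in tournament `i`: they have not lost in tournament `i`, and
they are done with each earlier tournament, by having lost in it or by having won it.
(If `x` waits in tournaments `j < i`, then `x` has already won tournament `j` and has no possible
opponent there; so a label plays at most one game per round.) -/
noncomputable def waiting {k m : ℕ} (S : State k m) (i : Fin m) : Finset (Fin k) :=
  (S i).filter fun x => ∀ j : Fin m, j < i → x ∉ S j ∨ S j = {x}

/-- The outcomes of all games.  `first t i x y` says that in round `t` of the first phase label `x`
beats label `y` in tournament `i`; `final r i j` says that in round `r` of the second phase
the entrant `i` (the winner of the `i`-th tournament of the first phase) prevails over the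
entrant `j`. -/
structure Outcomes (k m : ℕ) where
  first : ℕ → Fin m → Fin k → Fin k → Prop
  first_iff : ∀ t i x y, x ≠ y → (first t i x y ↔ ¬ first t i y x)
  final : ℕ → Fin m → Fin m → Prop
  final_iff : ∀ r i j, i ≠ j → (final r i j ↔ ¬ final r j i)

end EliminationTournament

/-- An `m`-elimination tournament on `k` labels.  In each round the pairings are chosen knowing the
earlier states (listed with the most recent one first) and the present state.
First phase: `m` simultaneous single-elimination tournaments.
Second phase: a single-elimination tournament between the `m` winners of the first phase, the state
being the set of entrants that are still in. -/
structure EliminationTournament (k m : ℕ) where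
  pairFirst : List (EliminationTournament.State k m) → EliminationTournament.State k m →
    Fin m → Fin k → Fin k
  pairFirst_isPairing : ∀ past S i,
    IsPairing (EliminationTournament.waiting S i) (pairFirst past S i)
  pairFinal : List (Finset (Fin m)) → Finset (Fin m) → Fin m → Fin m
  pairFinal_isPairing : ∀ past F, IsPairing F (pairFinal past F)

namespace EliminationTournament

open Classical in
/-- The earlier states and the state of the first phase after `t` rounds. -/
noncomputable def firstRun {k m : ℕ} (T : EliminationTournament k m) (ω : Outcomes k m) :
    ℕ → List (State k m) × State k m
  | 0 => ([], fun _ => Finset.univ)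
  | t + 1 =>
    let past := (firstRun T ω t).1
    let S := (firstRun T ω t).2
    (S :: past, fun i => (S i).filter fun x =>
      ¬ (x ∈ waiting S i ∧ T.pairFirst past S i x ≠ x ∧ ω.first t i (T.pairFirst past S i x) x))

open Classical in
/-- The earlier sets and the present set of remaining entrants after `r` rounds of the second
phase. -/
noncomputable def finalRun {k m : ℕ} (T : EliminationTournament k m) (ω : Outcomes k m) :
    ℕ → List (Finset (Fin m)) × Finset (Fin m)
  | 0 => ([], Finset.univ)
  | r + 1 =>
    let past := (finalRun T ω r).1
    let F := (finalRun T ω r).2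
    (F :: past, F.filter fun i =>
      ¬ (T.pairFinal past F i ≠ i ∧ ω.final r (T.pairFinal past F i) i))

/-- The opponent of the entrant `i` in round `r` of the second phase (`i` itself for a bye). -/
noncomputable def finalOpponent {k m : ℕ} (T : EliminationTournament k m) (ω : Outcomes k m)
    (r : ℕ) (i : Fin m) : Fin m :=
  T.pairFinal (finalRun T ω r).1 (finalRun T ω r).2 i

/-- The charge, after `r` rounds of the second phase, of the subtree whose winner is the remaining
entrant `i`: its number of leaves. -/
noncomputable def charge {k m : ℕ} (T : EliminationTournament k m) (ω : Outcomes k m) :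
    ℕ → Fin m → ℕ
  | 0, _ => 1
  | r + 1, i =>
    if finalOpponent T ω r i = i then charge T ω r i
    else charge T ω r i + charge T ω r (finalOpponent T ω r i)

/-- The number of times that the match between the entrants `i` and `j` is played in round `r` of
the second phase, `w` giving the label of each entrant: nothing is played between two copies of the
same label, and otherwise the importance weight is the charge of one of the two subtrees, in the
worst case the larger one. -/
noncomputable def matchWeight {k m : ℕ} (T : EliminationTournament k m) (ω : Outcomes k m)
    (w : Fin m → Fin k) (r : ℕ) (i j : Fin m) : ℕ :=
  if w i = w j then 0 else max (charge T ω r i) (charge T ω r j)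

/-- The length of round `r` of the second phase.  Its matches take place simultaneously, so
this is the length of the longest one; a bye contributes `0`, as `w i = w i`. -/
noncomputable def finalRoundLength {k m : ℕ} (T : EliminationTournament k m) (ω : Outcomes k m)
    (w : Fin m → Fin k) (r : ℕ) : ℕ :=
  (finalRun T ω r).2.sup fun i => matchWeight T ω w r i (finalOpponent T ω r i)

/-- With the outcomes `ω`, the whole tournament lasts for `d` games: the first phase takes `t₁`
rounds of one game until each of its `m` tournaments has a single label left, the label `w i` in
tournament `i`, and the second phase takes `t₂` rounds until a single entrant is left. -/
def LastsFor {k m : ℕ} (T : EliminationTournament k m) (ω : Outcomes k m) (d : ℕ) : Prop :=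
  ∃ (t₁ t₂ : ℕ) (w : Fin m → Fin k),
    IsLeast {t : ℕ | ∀ i, ((firstRun T ω t).2 i).card = 1} t₁ ∧
    (∀ i, (firstRun T ω t₁).2 i = {w i}) ∧
    IsLeast {r : ℕ | (finalRun T ω r).2.card = 1} t₂ ∧
    d = t₁ + ∑ r ∈ Finset.range t₂, finalRoundLength T ω w r

/-- The importance depth: the worst-case length of the overall tournament
(it is `⊤` if some outcomes make the tournament endless). -/
noncomputable def importanceDepth {k m : ℕ} (T : EliminationTournament k m) : ℕ∞ :=
  ⨆ ω : Outcomes k m, ⨅ (d : ℕ) (_ : LastsFor T ω d), (d : ℕ∞)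

end EliminationTournament

/-- `⌈m⌉₂`, the smallest power of `2` that is larger than or equal to `m`. -/
noncomputable def ceilPowTwo (m : ℕ) : ℕ :=
  sInf {n : ℕ | ∃ j : ℕ, n = 2 ^ j ∧ m ≤ n}

/-! Let `e_i` count the labels that still have to lose in `W_i`. Of the waiting labels, half
(rounded down) lose in each round, and all labels left in `W_i` wait, except at most `admitted
e_{i-1}` that are still busy in `W_{i-1}`. So one round gives `e_i' ≤ ⌊(e_i + admitted e_{i-1}) /
2⌋`, whatever the pairings and results. The right side is monotone, so every supersolution of this
recursion dominates the process (`card_firstRun_le`).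

A travelling wave `h (p * i - q * t + c)` turns the recursion into an inequality in one variable,
and it vanishes for all `m` tournaments once `q * t ≥ p * m + c` (`importanceDepth_le_of_wave`). A
linear, a Fibonacci and a power-of-two wave give the three explicit bounds. For the logarithmic
bound, the Fibonacci wave serves when `m ≤ 9/4 * ln k`; otherwise a wave doubling every five steps
does, or the linear one if `k < 5`.

In the second phase charges at most double per round, so the round lengths sum to at most `⌈m⌉₂ -
1`. -/

/-- In one round, half of the waiting competitors (rounded down) lose. -/
theorem IsPairing.card_losers {α : Type} {W L : Finset α} {σ : α → α} (h : IsPairing W σ)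
    {R : α → α → Prop} (hR : ∀ x y, x ≠ y → (R x y ↔ ¬ R y x))
    (hL : ∀ x, x ∈ L ↔ x ∈ W ∧ σ x ≠ x ∧ R (σ x) x) :
    2 * L.card ≤ W.card ∧ W.card ≤ 2 * L.card + 1 := by
  classical
  have hLW : L ⊆ W := fun x hx => ((hL x).1 hx).1
  have hinj : Set.InjOn σ L := fun x hx y hy hxy => by
    rw [← h.invol x (hLW hx), hxy, h.invol y (hLW hy)]
  have hV : (L.image σ).card = L.card := Finset.card_image_of_injOn hinj
  have hVW : L.image σ ⊆ W := Finset.image_subset_iff.2 fun x hx => h.mem x (hLW hx)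
  have hdisj : Disjoint L (L.image σ) := by
    rw [Finset.disjoint_left]
    intro y hy hyV
    obtain ⟨x, hx, rfl⟩ := Finset.mem_image.1 hyV
    obtain ⟨hxW, hne, hb⟩ := (hL x).1 hx
    have hb' := ((hL _).1 hy).2.2
    rw [h.invol x hxW] at hb'
    exact (hR _ _ hne).1 hb hb'
  have hsub : L ∪ L.image σ ⊆ W := Finset.union_subset hLW hVW
  have hcard : (L ∪ L.image σ).card = 2 * L.card := by
    rw [Finset.card_union_of_disjoint hdisj, hV, two_mul]
  have hfix : ∀ x ∈ W \ (L ∪ L.image σ), σ x = x := by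
    intro x hx
    obtain ⟨hxW, hxn⟩ := Finset.mem_sdiff.1 hx
    by_contra hne
    apply hxn
    by_cases hb : R (σ x) x
    · exact Finset.mem_union_left _ ((hL x).2 ⟨hxW, hne, hb⟩)
    · refine Finset.mem_union_right _ (Finset.mem_image.2 ⟨σ x, (hL _).2 ⟨h.mem x hxW, ?_, ?_⟩,
        h.invol x hxW⟩)
      · rw [h.invol x hxW]; exact fun e => hne e.symm
      · rw [h.invol x hxW]; exact (hR x (σ x) (Ne.symm hne)).2 hb
  have hbye : (W \ (L ∪ L.image σ)).card ≤ 1 := by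
    refine Finset.card_le_one.2 fun x hx y hy => ?_
    exact h.bye x (Finset.mem_sdiff.1 hx).1 y (Finset.mem_sdiff.1 hy).1 (hfix x hx) (hfix y hy)
  have := Finset.card_sdiff_add_card_eq_card hsub
  omega

/-- If `e` is the number of labels that still have to lose in a tournament, then all but `admitted e`
labels have left it for the next one. -/
def admitted (e : ℕ) : ℕ := if e = 0 then 0 else e + 1

theorem admitted_mono : Monotone admitted := by
  intro a b h
  simp only [admitted]
  split_ifs <;> omega

theorem ceilPowTwo_eq (m : ℕ) : ceilPowTwo m = 2 ^ Nat.clog 2 m := by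
  apply le_antisymm
  · exact Nat.sInf_le ⟨_, rfl, Nat.le_pow_clog one_lt_two m⟩
  · refine le_csInf ⟨_, _, rfl, Nat.le_pow_clog one_lt_two m⟩ ?_
    rintro n ⟨j, rfl, hj⟩
    exact Nat.pow_le_pow_right two_pos (Nat.clog_le_of_le_pow hj)

/-! ### Dynamics of the first phase -/

namespace EliminationTournament

variable {k m : ℕ}

/-- The label `x` has lost or won tournament `j`. -/
def IsDone (S : State k m) (j : Fin m) (x : Fin k) : Prop := x ∉ S j ∨ S j = {x}

theorem mem_waiting {S : State k m} {i : Fin m} {x : Fin k} :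
    x ∈ waiting S i ↔ x ∈ S i ∧ ∀ j < i, IsDone S j x := by
  simp [waiting, IsDone]

/-- The properties shared by all states that occur in the first phase. -/
structure IsReachable (S : State k m) : Prop where
  nonempty : ∀ i, (S i).Nonempty
  done_of_lost : ∀ i x, x ∉ S i → ∀ j < i, IsDone S j x

/-- If `x` has won `i`, any rival of `x` in an earlier `j` has lost in `i`, hence is done with `j`,
which is impossible while both are alive there. Thus waiting depends only on the immediately
preceding tournament. -/
theorem IsReachable.isDone_of_isDone {S : State k m} (hS : IsReachable S) {i j : Fin m}
    (hji : j < i) {x : Fin k} (hx : IsDone S i x) : IsDone S j x := by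
  rcases hx with hx | hx
  · exact hS.done_of_lost i x hx j hji
  · by_contra hnd
    simp only [IsDone, not_or, not_not] at hnd
    apply hnd.2
    refine Finset.eq_singleton_iff_unique_mem.2 ⟨hnd.1, fun y hy => ?_⟩
    by_contra hyx
    rcases hS.done_of_lost i y (by simp [hx, hyx]) j hji with h | h
    · exact h hy
    · have := hnd.1
      rw [h, Finset.mem_singleton] at this
      exact hyx this.symm

theorem waiting_zero {S : State k m} {i : Fin m}
    (hi : (i : ℕ) = 0) : waiting S i = S i := by
  ext x
  rw [mem_waiting]
  refine ⟨And.left, fun h => ⟨h, fun j hj => ?_⟩⟩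
  have : (j : ℕ) < i := hj
  omega

theorem IsReachable.mem_waiting_succ {S : State k m} (hS : IsReachable S) {i j : Fin m}
    (hij : (i : ℕ) = j + 1) {x : Fin k} : x ∈ waiting S i ↔ x ∈ S i ∧ IsDone S j x := by
  rw [mem_waiting]
  refine and_congr_right fun _ => ⟨fun h => h j (by rw [Fin.lt_def]; omega), fun h l hl => ?_⟩
  rcases eq_or_ne l j with rfl | hlj
  · exact h
  · refine hS.isDone_of_isDone ?_ h
    rw [Fin.lt_def] at hl ⊢
    have : (l : ℕ) ≠ j := fun e => hlj (Fin.ext e)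
    omega

theorem IsReachable.card_sub_half_waiting_zero {S : State k m} (hS : IsReachable S) {i : Fin m}
    (hi : (i : ℕ) = 0) :
    (S i).card - (waiting S i).card / 2 ≤ ((S i).card - 1) / 2 + 1 := by
  rw [waiting_zero hi]
  have := (hS.nonempty i).card_pos
  omega

theorem IsReachable.card_sub_half_waiting_succ {S : State k m} (hS : IsReachable S) {i j : Fin m}
    (hij : (i : ℕ) = j + 1) :
    (S i).card - (waiting S i).card / 2 ≤
      ((S i).card - 1 + admitted ((S j).card - 1)) / 2 + 1 := by
  have hi := (hS.nonempty i).card_pos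
  have hj := (hS.nonempty j).card_pos
  -- Once the predecessor is decided, even its winner has moved on, so nobody is withheld; this is
  -- why `admitted 0 = 0`.
  rcases eq_or_ne (S j).card 1 with h1 | h1
  · obtain ⟨z, hz⟩ := Finset.card_eq_one.1 h1
    have : waiting S i = S i := by
      ext x
      rw [hS.mem_waiting_succ hij]
      refine ⟨And.left, fun h => ⟨h, ?_⟩⟩
      rcases eq_or_ne x z with rfl | hx
      · exact Or.inr hz
      · exact Or.inl (by simp [hz, hx])
    rw [this]
    omega
  · have hsub : S i \ S j ⊆ waiting S i := by
      intro x hx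
      rw [Finset.mem_sdiff] at hx
      exact (hS.mem_waiting_succ hij).2 ⟨hx.1, Or.inl hx.2⟩
    have h2 := Finset.card_le_card hsub
    have h3 := Finset.le_card_sdiff (S j) (S i)
    have h4 : admitted ((S j).card - 1) = (S j).card := by
      rw [admitted, if_neg (by omega)]; omega
    rw [h4]
    omega

variable (T : EliminationTournament k m) (ω : Outcomes k m)

theorem mem_firstRun_succ (t : ℕ) (i : Fin m) (x : Fin k) :
    x ∈ (firstRun T ω (t + 1)).2 i ↔ x ∈ (firstRun T ω t).2 i ∧
      ¬ (x ∈ waiting (firstRun T ω t).2 i ∧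
        T.pairFirst (firstRun T ω t).1 (firstRun T ω t).2 i x ≠ x ∧
        ω.first t i (T.pairFirst (firstRun T ω t).1 (firstRun T ω t).2 i x) x) := by
  simp only [firstRun, Finset.mem_filter]

theorem firstRun_succ_subset (t : ℕ) (i : Fin m) :
    (firstRun T ω (t + 1)).2 i ⊆ (firstRun T ω t).2 i :=
  fun x hx => ((mem_firstRun_succ T ω t i x).1 hx).1

theorem card_firstRun_succ (t : ℕ) (i : Fin m) :
    ((firstRun T ω (t + 1)).2 i).card =
      ((firstRun T ω t).2 i).card - (waiting (firstRun T ω t).2 i).card / 2 := by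
  set S := (firstRun T ω t).2 with hS
  have hsub := firstRun_succ_subset T ω t i
  have h := (T.pairFirst_isPairing (firstRun T ω t).1 S i).card_losers
    (ω.first_iff t i) (L := S i \ (firstRun T ω (t + 1)).2 i) (fun x => by
      rw [Finset.mem_sdiff, mem_firstRun_succ, ← hS]
      have := @mem_waiting _ _ S i x
      tauto)
  have h2 := Finset.card_sdiff_add_card_eq_card hsub
  rw [← hS] at h2
  omega

theorem isReachable_firstRun (hk : 1 ≤ k) (t : ℕ) : IsReachable (firstRun T ω t).2 := by
  induction t with
  | zero =>
    refine ⟨fun i => ⟨⟨0, hk⟩, by simp [firstRun]⟩, fun i x hx => ?_⟩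
    simp [firstRun] at hx
  | succ t ih =>
    have hne : ∀ i, ((firstRun T ω (t + 1)).2 i).Nonempty := fun i => by
      rw [← Finset.card_pos, card_firstRun_succ]
      have h1 := (ih.nonempty i).card_pos
      have h2 : (waiting (firstRun T ω t).2 i).card ≤ ((firstRun T ω t).2 i).card :=
        Finset.card_le_card fun x hx => (mem_waiting.1 hx).1
      omega
    -- A won tournament stays won because its set shrinks but never becomes empty.
    have hpersist : ∀ j x, IsDone (firstRun T ω t).2 j x → IsDone (firstRun T ω (t + 1)).2 j x := by
      rintro j x (h | h)
      · exact Or.inl fun hx => h (firstRun_succ_subset T ω t j hx)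
      · refine Or.inr ?_
        have hs := firstRun_succ_subset T ω t j
        rw [h] at hs
        exact (hne j).subset_singleton_iff.1 hs
    refine ⟨hne, fun i x hx j hji => hpersist j x ?_⟩
    by_cases hxS : x ∈ (firstRun T ω t).2 i
    · rw [mem_firstRun_succ] at hx
      have hw : x ∈ waiting (firstRun T ω t).2 i := by tauto
      exact (mem_waiting.1 hw).2 j hji
    · exact ih.done_of_lost i x hxS j hji

/-- Any solution of the recursive inequality bounds the number of labels that still have to lose. -/
theorem card_firstRun_le (hk : 1 ≤ k) (E : ℕ → ℕ → ℕ) (hinit : ∀ i, k ≤ E (i + 1) 0 + 1)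
    (hstep : ∀ i t, k ≤ E (i + 1) (t + 1) + 1 ∨
      (E (i + 1) t + admitted (E i t)) / 2 ≤ E (i + 1) (t + 1)) (t : ℕ) (i : Fin m) :
    ((firstRun T ω t).2 i).card ≤ E (i + 1) t + 1 := by
  have hle : ∀ t (i : Fin m), ((firstRun T ω t).2 i).card ≤ k := fun t i => by
    simpa using Finset.card_le_univ ((firstRun T ω t).2 i)
  induction t generalizing i with
  | zero => exact (hle 0 i).trans (hinit i)
  | succ t ih =>
    -- The first alternative is free, as no tournament has more than `k` labels; it allows waves
    -- that are capped at height about `k`.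
    rcases hstep i t with h | h
    · exact (hle _ i).trans h
    · have hS := isReachable_firstRun T ω hk t
      rw [card_firstRun_succ]
      have hi := ih i
      have hi0 := (hS.nonempty i).card_pos
      rcases Nat.eq_zero_or_pos (i : ℕ) with h0 | h0
      · have := hS.card_sub_half_waiting_zero h0
        omega
      · have hj := ih ⟨i - 1, by omega⟩
        have hj' : ((i : ℕ) - 1 + 1) = i := by omega
        have := hS.card_sub_half_waiting_succ (i := i) (j := ⟨i - 1, by omega⟩) (by simp; omega)
        simp only [hj'] at hj
        have := admitted_mono (Nat.sub_le_iff_le_add.2 hj)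
        omega

/-! ### Cost of the second phase -/

theorem card_finalRun_succ (r : ℕ) :
    (finalRun T ω (r + 1)).2.card = (finalRun T ω r).2.card - (finalRun T ω r).2.card / 2 := by
  set F := (finalRun T ω r).2 with hF
  have hmem : ∀ x, x ∈ (finalRun T ω (r + 1)).2 ↔ x ∈ F ∧
      ¬ (T.pairFinal (finalRun T ω r).1 F x ≠ x ∧
        ω.final r (T.pairFinal (finalRun T ω r).1 F x) x) := fun x => by
    simp only [finalRun, Finset.mem_filter, hF]
  have hsub : (finalRun T ω (r + 1)).2 ⊆ F := fun x hx => ((hmem x).1 hx).1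
  have h := (T.pairFinal_isPairing (finalRun T ω r).1 F).card_losers
    (ω.final_iff r) (L := F \ (finalRun T ω (r + 1)).2) (fun x => by
      rw [Finset.mem_sdiff, hmem]
      tauto)
  have h2 := Finset.card_sdiff_add_card_eq_card hsub
  omega

theorem card_finalRun (hm : 1 ≤ m) (n r : ℕ) (h : m ≤ 2 ^ (n + r)) :
    1 ≤ (finalRun T ω r).2.card ∧ (finalRun T ω r).2.card ≤ 2 ^ n := by
  induction r generalizing n with
  | zero => simpa [finalRun] using ⟨hm, h⟩
  | succ r ih =>
    have := ih (n + 1) (by rwa [add_right_comm, add_assoc])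
    rw [card_finalRun_succ]
    rw [pow_succ] at this
    omega

theorem charge_le (r : ℕ) (i : Fin m) : charge T ω r i ≤ 2 ^ r := by
  induction r generalizing i with
  | zero => simp [charge]
  | succ r ih =>
    have h1 := ih i
    have h2 := ih (finalOpponent T ω r i)
    rw [charge, pow_succ]
    split_ifs <;> omega

theorem finalRoundLength_le (w : Fin m → Fin k) (r : ℕ) : finalRoundLength T ω w r ≤ 2 ^ r := by
  refine Finset.sup_le fun i _ => ?_
  rw [matchWeight]
  split_ifs
  · exact Nat.zero_le _
  · exact max_le (charge_le T ω r _) (charge_le T ω r _)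

theorem exists_lastsFor (hm : 1 ≤ m) (N : ℕ) (hN : ∀ i, ((firstRun T ω N).2 i).card = 1) :
    ∃ d, LastsFor T ω d ∧ d + 1 ≤ N + 2 ^ Nat.clog 2 m := by
  classical
  have hne : {t : ℕ | ∀ i, ((firstRun T ω t).2 i).card = 1}.Nonempty := ⟨N, hN⟩
  have hle := Nat.sInf_le (s := {t : ℕ | ∀ i, ((firstRun T ω t).2 i).card = 1}) hN
  have hmem := Nat.sInf_mem hne
  set t₁ := sInf {t : ℕ | ∀ i, ((firstRun T ω t).2 i).card = 1}
  have hF : Nat.clog 2 m ∈ {r : ℕ | (finalRun T ω r).2.card = 1} := by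
    have := card_finalRun T ω hm 0 (Nat.clog 2 m) (by simpa using Nat.le_pow_clog one_lt_two m)
    simp only [pow_zero] at this
    exact le_antisymm this.2 this.1
  have hle2 := Nat.sInf_le hF
  have hmem2 := Nat.sInf_mem ⟨_, hF⟩
  set t₂ := sInf {r : ℕ | (finalRun T ω r).2.card = 1}
  choose w hw using fun i => Finset.card_eq_one.1 (hmem i)
  refine ⟨_, ⟨t₁, t₂, w, ⟨hmem, fun t ht => Nat.sInf_le ht⟩, hw,
    ⟨hmem2, fun t ht => Nat.sInf_le ht⟩, rfl⟩, ?_⟩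
  have h1 : ∑ r ∈ Finset.range t₂, finalRoundLength T ω w r ≤ ∑ r ∈ Finset.range t₂, 2 ^ r :=
    Finset.sum_le_sum fun r _ => finalRoundLength_le T ω w r
  have h2 := Nat.geomSum_eq (le_refl 2) t₂
  have h3 : 2 ^ t₂ ≤ 2 ^ Nat.clog 2 m := Nat.pow_le_pow_right two_pos hle2
  have h4 : 0 < 2 ^ t₂ := by positivity
  omega

/-! ### From supersolutions to depth bounds -/

theorem importanceDepth_le_of_recursion (hk : 1 ≤ k) (hm : 1 ≤ m) (E : ℕ → ℕ → ℕ)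
    (hinit : ∀ i, k ≤ E (i + 1) 0 + 1)
    (hstep : ∀ i t, k ≤ E (i + 1) (t + 1) + 1 ∨
      (E (i + 1) t + admitted (E i t)) / 2 ≤ E (i + 1) (t + 1))
    (N : ℕ) (hN : ∀ i < m, E (i + 1) N = 0) :
    T.importanceDepth ≤ ((N + ceilPowTwo m - 1 : ℕ) : ℕ∞) := by
  refine iSup_le fun ω => ?_
  obtain ⟨d, hd, hle⟩ := exists_lastsFor T ω hm N fun i => by
    have h1 := card_firstRun_le T ω hk E hinit hstep N i
    have h2 := ((isReachable_firstRun T ω hk N).nonempty i).card_pos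
    rw [hN i i.2] at h1
    omega
  refine (iInf₂_le d hd).trans ?_
  rw [ceilPowTwo_eq]
  exact_mod_cast (by omega : d ≤ N + 2 ^ Nat.clog 2 m - 1)

/-- A travelling wave `h (p * i - q * t + c)` bounds the length of the tournament. -/
theorem importanceDepth_le_of_wave (hk : 1 ≤ k) (hm : 1 ≤ m) (h : ℕ → ℕ) (p q : ℕ) (c : ℤ)
    (hzero : h 0 = 0)
    (hstep : ∀ n, k ≤ h (n + 1 - q) + 1 ∨
      (h (n + 1) + admitted (h (n + 1 - p))) / 2 ≤ h (n + 1 - q))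
    (hinit : ∀ n : ℕ, k ≤ h (p * (n + 1) + c).toNat + 1) (N : ℕ) (hN : p * m + c ≤ q * N) :
    T.importanceDepth ≤ ((N + ceilPowTwo m - 1 : ℕ) : ℕ∞) := by
  refine T.importanceDepth_le_of_recursion hk hm (fun i t => h (p * i - q * t + c).toNat)
    (fun i => by simpa using hinit i) (fun i t => ?_) N (fun i hi => ?_)
  · push_cast
    have h1 : (p : ℤ) * (i + 1) - q * (t + 1) + c = p * (i + 1) - q * t + c - q := by ring
    have h2 : (p : ℤ) * i - q * t + c = p * (i + 1) - q * t + c - p := by ring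
    rw [h1, h2]
    generalize (p : ℤ) * (i + 1) - q * t + c = x
    -- Truncation at zero commutes with subtracting a natural number, so only natural arguments of
    -- `h` matter.
    have hq : (x - q).toNat = x.toNat - q := by omega
    have hp : (x - p).toNat = x.toNat - p := by omega
    rw [hq, hp]
    cases x.toNat with
    | zero => exact Or.inr (by simp [hzero, admitted])
    | succ n => exact hstep n
  · have : (p : ℤ) * ((i + 1 : ℕ) : ℤ) ≤ p * m := by
      gcongr
      omega
    have h0 : ((p : ℤ) * ((i + 1 : ℕ) : ℤ) - q * N + c).toNat = 0 :=
      Int.toNat_eq_zero.2 (by linarith)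
    simp only [h0, hzero]

end EliminationTournament

/-! ### Growth of the Fibonacci and doubling waves -/

/-- Three Fibonacci steps multiply by at least 4, hence 1.5 steps per factor 2. This makes the
Fibonacci wave start above `k`. -/
theorem two_pow_add_two_le_two_mul_fib (L : ℕ) :
    2 ^ (L + 1) + 2 ≤ 2 * Nat.fib ((3 * (L + 1) + 1) / 2 + 1) := by
  induction L using Nat.twoStepInduction with
  | zero => decide
  | one => decide
  | more L ih _ =>
    obtain ⟨n, hn⟩ : ∃ n, (3 * (L + 1) + 1) / 2 + 1 = n + 2 :=
      ⟨(3 * (L + 1) + 1) / 2 - 1, by omega⟩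
    have hn' : (3 * (L + 2 + 1) + 1) / 2 + 1 = n + 5 := by omega
    rw [hn] at ih
    rw [hn']
    have h2 := Nat.fib_add_two (n := n)
    have h3 := Nat.fib_add_two (n := n + 1)
    have h4 := Nat.fib_add_two (n := n + 2)
    have h5 := Nat.fib_add_two (n := n + 3)
    have h1 := Nat.fib_le_fib_succ (n := n)
    simp only [add_assoc, Nat.reduceAdd] at h2 h3 h4 h5 h1
    have : 2 ^ (L + 2 + 1) = 4 * 2 ^ (L + 1) := by ring
    omega

/-- A travelling wave of speed `2 / 5` which doubles every five steps. -/
def doublingWave : ℕ → ℕ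
  | 0 => 0
  | 1 => 1
  | 2 => 1
  | 3 => 2
  | 4 => 3
  | 5 => 4
  | 6 => 5
  | 7 => 7
  | 8 => 8
  | 9 => 11
  | 10 => 12
  | 11 => 14
  | 12 => 16
  | 13 => 18
  | 14 => 21
  | n + 15 => 2 * doublingWave (n + 10)

theorem doublingWave_add_fifteen (n : ℕ) : doublingWave (n + 15) = 2 * doublingWave (n + 10) :=
  doublingWave.eq_16 n

/-- From `n = 14` on, the inequality is twice the one at `n - 5`; the rest is a finite check. -/
theorem doublingWave_add_le (n : ℕ) :
    doublingWave (n + 6) + doublingWave (n + 1) ≤ 2 * doublingWave (n + 4) := by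
  induction n using Nat.strong_induction_on with
  | _ n ih =>
    rcases lt_or_ge n 14 with h | h
    · interval_cases n <;> simp [doublingWave]
    · obtain ⟨l, rfl⟩ := Nat.exists_eq_add_of_le' h
      have := ih (l + 9) (by omega)
      simp only [add_assoc, Nat.reduceAdd] at this ⊢
      rw [doublingWave_add_fifteen (l + 5), doublingWave_add_fifteen l,
        doublingWave_add_fifteen (l + 3)]
      have h15 := doublingWave_add_fifteen l
      simp only [add_assoc, Nat.reduceAdd]
      omega

theorem two_pow_le_doublingWave (j : ℕ) : 2 ^ (j + 3) ≤ doublingWave (5 * j + 7) + 1 := by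
  rcases j with _ | j
  · simp [doublingWave]
  · have : doublingWave (5 * (j + 1) + 7) = 2 ^ (j + 1 + 3) := by
      induction j with
      | zero => simp [doublingWave]
      | succ j ih =>
        rw [show 5 * (j + 1 + 1) + 7 = 5 * j + 2 + 15 by ring, doublingWave_add_fifteen,
          show 5 * j + 2 + 10 = 5 * (j + 1) + 7 by ring, ih]
        ring
    omega

/-! ### The four waves -/

namespace EliminationTournament

variable {k m : ℕ} (T : EliminationTournament k m)

/-- On an arithmetic progression the average is exact, and the floor absorbs the `+ 1` of
`admitted`. -/
theorem importanceDepth_le_half (hk : 1 ≤ k) (hm : 1 ≤ m) :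
    T.importanceDepth ≤ (((k + 1) / 2 + 2 * m - 2 + ceilPowTwo m - 1 : ℕ) : ℕ∞) := by
  refine T.importanceDepth_le_of_wave hk hm (fun x => 2 * x - 1) 2 1 (((k + 1) / 2 : ℕ) - 2) rfl
    (fun n => Or.inr ?_) (fun n => ?_) _ ?_
  · simp only [admitted]
    split_ifs <;> omega
  · omega
  · omega

/-- The recursion for this wave is `F (l + 6) + F (l + 3) = 2 * F (l + 5)`; the offset `- 3`
accounts for `admitted` and the floor. -/
theorem importanceDepth_le_fib (hk : 2 ≤ k) (hm : 1 ≤ m) :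
    T.importanceDepth ≤
      ((3 * m + (3 * Nat.clog 2 k + 1) / 2 - 4 + ceilPowTwo m - 1 : ℕ) : ℕ∞) := by
  have hL := Nat.clog_pos one_lt_two hk
  have hkL := Nat.le_pow_clog one_lt_two k
  obtain ⟨L, hL'⟩ : ∃ L, Nat.clog 2 k = L + 1 := ⟨_, (Nat.succ_pred_eq_of_pos hL).symm⟩
  rw [hL'] at hkL ⊢
  refine T.importanceDepth_le_of_wave (by omega) hm (fun x => 2 * Nat.fib (x + 2) - 3) 3 1
    (((3 * (L + 1) + 1) / 2 : ℕ) - 4) rfl (fun n => Or.inr ?_) (fun n => ?_) _ ?_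
  · rcases lt_or_ge n 3 with h | h
    · interval_cases n <;> decide
    · obtain ⟨l, rfl⟩ := Nat.exists_eq_add_of_le' h
      have e1 : l + 3 + 1 - 3 = l + 1 := by omega
      have e2 : l + 3 + 1 - 1 = l + 3 := by omega
      simp only [e1, e2, add_assoc, Nat.reduceAdd, admitted]
      have h4 := Nat.fib_add_two (n := l + 2)
      have h5 := Nat.fib_add_two (n := l + 3)
      have h6 := Nat.fib_add_two (n := l + 4)
      have h3 : 2 ≤ Nat.fib (l + 3) := Nat.fib_mono (show 3 ≤ l + 3 by omega)
      simp only [add_assoc, Nat.reduceAdd] at h4 h5 h6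
      split_ifs <;> omega
  · have h1 := two_pow_add_two_le_two_mul_fib L
    have h2 : Nat.fib ((3 * (L + 1) + 1) / 2 + 1) ≤
        Nat.fib ((((3 : ℕ) : ℤ) * (n + 1) + (((3 * (L + 1) + 1) / 2 : ℕ) - 4)).toNat + 2) :=
      Nat.fib_mono (by omega)
    omega
  · omega

/-- Up to `x = τ` there is no inflow and the wave is pure halving, `2 ^ x - 1`. At `x = τ + y + 1`
the inflow is at most `2 ^ (y + 1)`, paid for by the factor `2 ^ τ - y` changing by one per round.
Since `2 ^ τ ≥ L + 1`, this factor is still positive at `y = L`, where the cap takes over. -/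
theorem importanceDepth_le_clog (hk : 1 ≤ k) (hm : 1 ≤ m) :
    T.importanceDepth ≤ ((Nat.clog 2 k + m * Nat.clog 2 (Nat.clog 2 k + 1)
      + ceilPowTwo m - 1 : ℕ) : ℕ∞) := by
  have hkL := Nat.le_pow_clog one_lt_two k
  have hLτ := Nat.le_pow_clog one_lt_two (Nat.clog 2 k + 1)
  generalize Nat.clog 2 (Nat.clog 2 k + 1) = τ at *
  generalize Nat.clog 2 k = L at *
  have htop : 2 ^ L ≤ 2 ^ L * (2 ^ τ - L) := Nat.le_mul_of_pos_right _ (by omega)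
  refine T.importanceDepth_le_of_wave hk hm
    (fun x => if x ≤ τ + L then 2 ^ (x - τ) * (2 ^ min x τ - (x - τ)) - 1 else 2 ^ L) τ 1 L
    (by simp) (fun n => ?_) (fun n => ?_) _ ?_
  · rcases lt_or_ge n τ with h | h
    · have e1 : n + 1 - τ = 0 := by omega
      have e2 : n - τ = 0 := by omega
      have e3 : min (n + 1) τ = n + 1 := by omega
      have e4 : min n τ = n := by omega
      rw [if_pos (by omega), if_pos (by omega)]
      simp only [Nat.add_sub_cancel, e1, e2, e3, e4, pow_succ, admitted]
      simp
      omega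
    · obtain ⟨y, rfl⟩ := Nat.exists_eq_add_of_le h
      rcases lt_or_ge y L with hy | hy
      · right
        have hadm : admitted (if y + 1 ≤ τ + L then
            2 ^ (y + 1 - τ) * (2 ^ min (y + 1) τ - (y + 1 - τ)) - 1 else 2 ^ L) ≤ 2 ^ (y + 1) := by
          rw [if_pos (by omega)]
          have : 2 ^ (y + 1 - τ) * (2 ^ min (y + 1) τ - (y + 1 - τ)) ≤ 2 ^ (y + 1) := by
            calc _ ≤ 2 ^ (y + 1 - τ) * 2 ^ min (y + 1) τ := Nat.mul_le_mul_left _ (Nat.sub_le _ _)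
              _ = 2 ^ (y + 1) := by rw [← pow_add]; congr 1; omega
          have : 0 < 2 ^ (y + 1) := by positivity
          rw [admitted]
          split_ifs <;> omega
        have e1 : τ + y + 1 - τ = y + 1 := by omega
        have e2 : τ + y + 1 - 1 = τ + y := by omega
        have e3 : τ + y - τ = y := by omega
        have e4 : min (τ + y + 1) τ = τ := by omega
        have e5 : min (τ + y) τ = τ := by omega
        simp only [e1, e2]
        rw [if_pos (by omega : τ + y + 1 ≤ τ + L), if_pos (by omega : τ + y ≤ τ + L), e3, e4, e5]
        obtain ⟨z, hz⟩ : ∃ z, 2 ^ τ = y + 1 + z := ⟨2 ^ τ - (y + 1), by omega⟩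
        have e6 : 2 ^ τ - (y + 1) = z := by omega
        have e7 : 2 ^ τ - y = z + 1 := by omega
        rw [e6, e7]
        have e8 : 2 ^ (y + 1) * z = 2 * (2 ^ y * z) := by ring
        have e9 : 2 ^ y * (z + 1) = 2 ^ y * z + 2 ^ y := by ring
        have e10 : 2 ^ (y + 1) = 2 * 2 ^ y := by ring
        have hz0 : 1 ≤ z := by omega
        have : 2 ^ y ≤ 2 ^ y * z := Nat.le_mul_of_pos_right _ hz0
        have : 0 < 2 ^ y := by positivity
        omega
      · left
        simp only [Nat.add_sub_cancel]
        split_ifs with hc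
        · obtain rfl : y = L := by omega
          simp only [Nat.add_sub_cancel_left, min_eq_right (Nat.le_add_right τ y)]
          omega
        · omega
  · have e : ((τ : ℤ) * (n + 1) + L).toNat = τ + L + τ * n := by
      have : (τ : ℤ) * (n + 1) + L = ((τ + L + τ * n : ℕ) : ℤ) := by push_cast; ring
      rw [this, Int.toNat_natCast]
    simp only [e]
    split_ifs with hc
    · have e0 : τ * n = 0 := by omega
      simp only [e0, add_zero, Nat.add_sub_cancel_left, min_eq_right (Nat.le_add_right τ L)]
      omega
    · omega
  · push_cast
    linarith

theorem importanceDepth_le_doubling (hk : 5 ≤ k) (hm : 1 ≤ m) :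
    T.importanceDepth ≤
      (((5 * m + 5 * Nat.clog 2 k - 12) / 2 + ceilPowTwo m - 1 : ℕ) : ℕ∞) := by
  have hkL := Nat.le_pow_clog one_lt_two k
  have hL : 2 < Nat.clog 2 k := (Nat.lt_clog_iff_pow_lt one_lt_two).2 (by omega)
  obtain ⟨L, hL'⟩ : ∃ L, Nat.clog 2 k = L + 3 := ⟨Nat.clog 2 k - 3, by omega⟩
  rw [hL'] at hkL ⊢
  refine T.importanceDepth_le_of_wave (by omega) hm doublingWave 5 2 (5 * L + 2) rfl
    (fun n => Or.inr ?_) (fun n => ?_) _ ?_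
  · rcases lt_or_ge n 5 with h | h
    · interval_cases n <;> simp [doublingWave, admitted]
    · obtain ⟨l, rfl⟩ := Nat.exists_eq_add_of_le' h
      have h1 := doublingWave_add_le l
      have e1 : l + 5 + 1 - 5 = l + 1 := by omega
      have e2 : l + 5 + 1 - 2 = l + 4 := by omega
      rw [e1, e2, add_right_comm l 5 1, admitted]
      simp only [add_assoc, Nat.reduceAdd] at h1 ⊢
      split_ifs <;> omega
  · have e : (((5 : ℕ) : ℤ) * (n + 1) + (5 * L + 2)).toNat = 5 * (L + n) + 7 := by omega
    rw [e]
    have h1 := two_pow_le_doublingWave (L + n)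
    have h2 : 2 ^ (L + 3) ≤ 2 ^ (L + n + 3) := Nat.pow_le_pow_right two_pos (by omega)
    omega
  · omega

end EliminationTournament

/-! ### The logarithmic bound -/

theorem add_le_two_mul_sqrt_of_le {m A : ℝ} (hm : 1 ≤ m) (hA : A ≤ 43) (h : m ≤ 9 / 4 * A) :
    m + 0.1643 * A - 3 ≤ 2 * √(m * A) := by
  have hA0 : 0 ≤ A := by linarith
  obtain ⟨s, hs0, rfl⟩ : ∃ s, 0 ≤ s ∧ m = s ^ 2 :=
    ⟨√m, Real.sqrt_nonneg m, (Real.sq_sqrt (by linarith : 0 ≤ m)).symm⟩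
  obtain ⟨a, ha0, rfl⟩ : ∃ a, 0 ≤ a ∧ A = a ^ 2 :=
    ⟨√A, Real.sqrt_nonneg A, (Real.sq_sqrt hA0).symm⟩
  rw [← mul_pow, Real.sqrt_sq (mul_nonneg hs0 ha0)]
  have hs1 : 1 ≤ s := by nlinarith
  have hsa : s ≤ 3 / 2 * a := abs_le_of_sq_le_sq' (by linarith) (by positivity) |>.2
  have ha7 : a ≤ 7 := by nlinarith
  -- The claim is convex in `s`, so the product of the distances to the ends of the range of `s` is
  -- the useful certificate.
  have h1 : 0 ≤ (s - 1) * (3 / 2 * a - s) := mul_nonneg (by linarith) (by linarith)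
  rcases le_total a 2 with h2 | h2
  · nlinarith
  · nlinarith [mul_nonneg (sub_nonneg.2 hs1) (sub_nonneg.2 h2)]

theorem add_le_two_mul_sqrt_of_ge {m A : ℝ} (hA : 0 ≤ A) (h : 9 / 4 * A ≤ m) (h' : m ≤ 6 * A) :
    m / 2 + 1.61 * A ≤ 2 * √(m * A) + 1 := by
  have hm : 0 ≤ m := by linarith
  obtain ⟨s, hs0, rfl⟩ : ∃ s, 0 ≤ s ∧ m = s ^ 2 :=
    ⟨√m, Real.sqrt_nonneg m, (Real.sq_sqrt hm).symm⟩
  obtain ⟨a, ha0, rfl⟩ : ∃ a, 0 ≤ a ∧ A = a ^ 2 :=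
    ⟨√A, Real.sqrt_nonneg A, (Real.sq_sqrt hA).symm⟩
  rw [← mul_pow, Real.sqrt_sq (mul_nonneg hs0 ha0)]
  have h1 : 3 / 2 * a ≤ s := abs_le_of_sq_le_sq' (by linarith) (by positivity) |>.2
  have h2 : s ≤ 5 / 2 * a := abs_le_of_sq_le_sq' (by linarith) (by positivity) |>.2
  nlinarith [mul_nonneg (sub_nonneg.2 h1) (sub_nonneg.2 h2)]

theorem clog_two_le_mul_log {k : ℕ} (hk : 1 ≤ k) :
    (Nat.clog 2 k : ℝ) ≤ 1.4428 * Real.log k + 1 := by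
  have hlog : 0 ≤ Real.log k := Real.log_natCast_nonneg k
  have h1 : (Nat.clog 2 k : ℝ) < Real.logb 2 k + 1 := by
    rw [← Nat.cast_ofNat (n := 2), ← Real.natCeil_logb_natCast]
    exact Nat.ceil_lt_add_one (Real.logb_nonneg (by norm_num) (by exact_mod_cast hk))
  have h2 : Real.logb 2 k ≤ 1.4428 * Real.log k := by
    rw [Real.logb, div_le_iff₀ (Real.log_pos one_lt_two)]
    nlinarith [Real.log_two_gt_d9]
  linarith

namespace EliminationTournament

variable {k m : ℕ} (T : EliminationTournament k m)

/-- The cast to the reals of a bound for the importance depth. -/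
theorem cast_le_of_importanceDepth_eq {d N : ℕ} (hd : T.importanceDepth = d)
    (h : T.importanceDepth ≤ ((N + ceilPowTwo m - 1 : ℕ) : ℕ∞)) :
    (d : ℝ) + 1 ≤ N + ceilPowTwo m := by
  rw [hd, Nat.cast_le] at h
  have : 0 < ceilPowTwo m := by rw [ceilPowTwo_eq]; positivity
  exact_mod_cast (by omega : d + 1 ≤ N + ceilPowTwo m)

theorem importanceDepth_le_log (hk : 1 ≤ k) (hm : 1 ≤ m) (hk62 : k ≤ 2 ^ 62)
    (hmk : (m : ℝ) ≤ 4 * Real.logb 2 k) {d : ℕ} (hd : T.importanceDepth = d) :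
    (d : ℝ) ≤ 2 * m + ceilPowTwo m + 2 * Real.log k + 2 * √(m * Real.log k) := by
  have hlog : 0 ≤ Real.log k := Real.log_natCast_nonneg k
  have hm' : (1 : ℝ) ≤ m := by exact_mod_cast hm
  have hL := clog_two_le_mul_log hk
  have hk2 : 2 ≤ k := by
    by_contra hlt
    obtain rfl : k = 1 := by omega
    simp at hmk
    omega
  have hL0 := Nat.clog_pos one_lt_two hk2
  rcases le_total (m : ℝ) (9 / 4 * Real.log k) with h | h
  · have h43 : Real.log k ≤ 43 := by
      calc Real.log k ≤ Real.log (2 ^ 62) :=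
            Real.log_le_log (by positivity) (by exact_mod_cast hk62)
        _ = 62 * Real.log 2 := by rw [Real.log_pow]; norm_num
        _ ≤ 43 := by linarith [Real.log_two_lt_d9]
    have h1 := T.cast_le_of_importanceDepth_eq hd (T.importanceDepth_le_fib hk2 hm)
    have h3 : 2 * ((3 * m + (3 * Nat.clog 2 k + 1) / 2 - 4 : ℕ) : ℝ) + 7 ≤
        6 * m + 3 * Nat.clog 2 k := by
      exact_mod_cast (by omega)
    linarith [add_le_two_mul_sqrt_of_le hm' h43 h]
  · rcases lt_or_ge k 5 with h5 | h5
    -- For `k < 5` the linear wave already takes at most `2 * m` rounds.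
    · have h1 := T.cast_le_of_importanceDepth_eq hd (T.importanceDepth_le_half hk hm)
      have h2 : (((k + 1) / 2 + 2 * m - 2 : ℕ) : ℝ) ≤ 2 * m := by
        exact_mod_cast (by omega)
      linarith [Real.sqrt_nonneg (m * Real.log k)]
    · have h6 : (m : ℝ) ≤ 6 * Real.log k := by
        have : Real.logb 2 k * Real.log 2 = Real.log k := by
          rw [Real.logb, div_mul_cancel₀ _ (Real.log_pos one_lt_two).ne']
        have h0 : 0 ≤ Real.logb 2 k := by linarith
        nlinarith [Real.log_two_gt_d9]
      have h1 := T.cast_le_of_importanceDepth_eq hd (T.importanceDepth_le_doubling h5 hm)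
      have h4 : 2 * (((5 * m + 5 * Nat.clog 2 k - 12) / 2 : ℕ) : ℝ) + 12 ≤
          5 * m + 5 * Nat.clog 2 k := by
        have : 2 < Nat.clog 2 k := (Nat.lt_clog_iff_pow_lt one_lt_two).2 (by omega)
        exact_mod_cast (by omega)
      linarith [add_le_two_mul_sqrt_of_ge hlog h h6]

end EliminationTournament

theorem mainTheorem5 (k m : ℕ) (hk : 1 ≤ k) (hm : 1 ≤ m) (T : EliminationTournament k m) :
    ∃ d : ℕ, T.importanceDepth = (d : ℕ∞) ∧
      (d : ℝ) ≤ (⌈Real.logb 2 k⌉₊ : ℝ)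
        + m * (⌈Real.logb 2 ((⌈Real.logb 2 k⌉₊ : ℝ) + 1)⌉₊ : ℝ) + (ceilPowTwo m : ℝ) ∧
      (d : ℝ) ≤ 1.5 * (⌈Real.logb 2 k⌉₊ : ℝ) + 3 * m + (ceilPowTwo m : ℝ) ∧
      (d : ℝ) ≤ (⌈(k : ℝ) / 2⌉₊ : ℝ) + 2 * m + (ceilPowTwo m : ℝ) ∧
      (k ≤ 2 ^ 62 → (m : ℝ) ≤ 4 * Real.logb 2 k →
        (d : ℝ) ≤ 2 * m + (ceilPowTwo m : ℝ) + 2 * Real.log k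
          + 2 * Real.sqrt (m * Real.log k)) := by
  have hclog : ∀ n : ℕ, ⌈Real.logb 2 n⌉₊ = Nat.clog 2 n := fun n => by
    exact_mod_cast Real.natCeil_logb_natCast 2 n
  have hhalf := T.importanceDepth_le_half hk hm
  obtain ⟨d, hd⟩ := ENat.ne_top_iff_exists.1 (ne_top_of_le_ne_top (ENat.natCast_ne_top _) hhalf)
  have hdhalf := T.cast_le_of_importanceDepth_eq hd.symm hhalf
  refine ⟨d, hd.symm, ?_, ?_, ?_, fun h1 h2 => T.importanceDepth_le_log hk hm h1 h2 hd.symm⟩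
  · have h := T.cast_le_of_importanceDepth_eq hd.symm (T.importanceDepth_le_clog hk hm)
    have h2 := hclog (Nat.clog 2 k + 1)
    push_cast at h h2
    rw [hclog, h2]
    linarith
  · rw [hclog]
    rcases hk.eq_or_lt with rfl | hk2
    · have : (((1 + 1) / 2 + 2 * m - 2 : ℕ) : ℝ) ≤ 3 * m := by exact_mod_cast (by omega)
      have : (0 : ℝ) ≤ Nat.clog 2 1 := Nat.cast_nonneg _
      linarith
    · have h := T.cast_le_of_importanceDepth_eq hd.symm (T.importanceDepth_le_fib hk2 hm)
      have h3 : 2 * ((3 * m + (3 * Nat.clog 2 k + 1) / 2 - 4 : ℕ) : ℝ) ≤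
          6 * m + 3 * Nat.clog 2 k + 1 := by
        exact_mod_cast (by omega)
      linarith
  · have h2 : (((k + 1) / 2 + 2 * m - 2 : ℕ) : ℝ) ≤ (⌈(k : ℝ) / 2⌉₊ : ℝ) + 2 * m := by
      have h3 : (k + 1) / 2 ≤ ⌈(k : ℝ) / 2⌉₊ := by
        have : (k : ℝ) ≤ 2 * ⌈(k : ℝ) / 2⌉₊ := by linarith [Nat.le_ceil ((k : ℝ) / 2)]
        have : k ≤ 2 * ⌈(k : ℝ) / 2⌉₊ := by exact_mod_cast this
        omega
      exact_mod_cast (by omega)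
    linarith
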